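/- Let $G=(V,E)$ be a finite simple graph of order $n=|V|$ (not necessarily connected), where the vertex set $V$ is linearly ordered (for example $V=\{1,2,\ldots,n\}$). Let $P(G,x)$ be its chromatic polynomial, i.e. the polynomial whose value at every positive integer $k$ is the number of proper $k$-colorings of $G$, and for $1\le i\le n$ let $a_i(G)$ be $(-1)^{n-i}$ times the coefficient of $x^i$ in $P(G,x)$. For a graph $H$ and a vertex $w$ of $H$, let $\alpha(H,w)$ be the number of acyclic orientations of $H$ in which $w$ is the unique source (vertex of in-degree zero). For $v\in V$ and $1\le i\le n$, let $\mathcal{OP}_{i,v}(V)$ be the set of ordered partitions $(V_1,V_2,\ldots,V_i)$ of $V$ into non-empty parts such that (a) every induced subgraph $G[V_j]$, $1\le j\le i$, is connected, and $v\in V_1$; (b) for every $j=2,\ldots,i$, the least element of $\bigcup_{j\le s\le i}V_s$ belongs to $V_j$. Then for every $v\in V$ and every $1\le i\le n$, $$a_i(G)=\sum_{(V_1,\ldots,V_i)\in\mathcal{OP}_{i,v}(V)}\alpha(G[V_1],v)\prod_{j=2}^{i}\alpha(G[V_j],m_j),$$ where $m_j$ is the least vertex in $V_j$ for $j=2,\ldots,i$.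 -/

import Mathlib

open Polynomial

noncomputable section

namespace ChromaticCoeff

/-! ### The chromatic polynomial and the numbers `a_i(G)` -/

/-- The number of proper `k`-colorings of `G`. -/
def numColorings {V : Type*} (G : SimpleGraph V) (k : ℕ) : ℕ :=
  Nat.card (G.Coloring (Fin k))

open scoped Classical in
/-- There is an integer polynomial that counts the proper `k`-colorings of a finite graph,
so the chromatic polynomial below is well defined. -/
theorem exists_chromaticPolynomial {V : Type*} [Fintype V] (G : SimpleGraph V) :
    ∃ P : ℤ[X], ∀ k : ℕ, 1 ≤ k → P.eval (k : ℤ) = numColorings G k := by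
  refine ⟨∑ S ∈ G.edgeFinset.powerset, (-1) ^ S.card *
    X ^ Nat.card (SimpleGraph.fromEdgeSet (S : Set (Sym2 V))).ConnectedComponent, fun k _ => ?_⟩
  have hcount : ∀ S : Finset (Sym2 V), S ⊆ G.edgeFinset →
      ((k : ℤ) ^ Nat.card (SimpleGraph.fromEdgeSet (S : Set (Sym2 V))).ConnectedComponent) =
        ∑ f : V → Fin k, if ∀ e ∈ S, (e.map f).IsDiag then 1 else 0 := by
    intro S hS
    let H := SimpleGraph.fromEdgeSet (S : Set (Sym2 V))
    have e : (H.ConnectedComponent → Fin k) ≃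
        {f : V → Fin k // ∀ e ∈ S, (e.map f).IsDiag} :=
      { toFun := fun g => ⟨fun v => g (H.connectedComponentMk v), by
          intro e
          induction e with | _ u v
          intro he
          have hadj : H.Adj u v := by
            have h1 := hS he
            rw [SimpleGraph.mem_edgeFinset, SimpleGraph.mem_edgeSet] at h1
            exact (SimpleGraph.fromEdgeSet_adj _).2 ⟨he, h1.ne⟩
          simp only [Sym2.map_mk, Sym2.mk_isDiag_iff]
          exact congrArg g (SimpleGraph.ConnectedComponent.sound hadj.reachable)⟩
        invFun := fun f => SimpleGraph.ConnectedComponent.lift f.1 (by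
          intro v w p _
          induction p with
          | nil => rfl
          | cons h _ ih =>
            rename_i hp
            have h2 := f.2 _ ((SimpleGraph.fromEdgeSet_adj _).1 h).1
            simp only [Sym2.map_mk, Sym2.mk_isDiag_iff] at h2
            exact h2.trans (ih hp.of_cons))
        left_inv := by
          intro g
          funext c
          induction c using SimpleGraph.ConnectedComponent.ind
          rfl
        right_inv := by
          intro f
          rfl }
    have h3 := Nat.card_congr e
    rw [Nat.card_fun, Nat.card_fin, Nat.card_eq_fintype_card (α := Subtype _),
      Fintype.card_subtype] at h3
    rw [Finset.sum_boole, ← h3]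
    push_cast
    rfl
  have hprod : ∀ f : V → Fin k,
      (∑ S ∈ G.edgeFinset.powerset,
        (-1 : ℤ) ^ S.card * if ∀ e ∈ S, (e.map f).IsDiag then 1 else 0) =
      if ∀ u v, G.Adj u v → f u ≠ f v then 1 else 0 := by
    intro f
    have h4 := Finset.prod_add (fun e : Sym2 V => -(if (e.map f).IsDiag then (1 : ℤ) else 0))
      (fun _ => 1) G.edgeFinset
    have h5 : ∀ S : Finset (Sym2 V),
        (∏ e ∈ S, -(if (e.map f).IsDiag then (1 : ℤ) else 0)) =
          (-1 : ℤ) ^ S.card * if ∀ e ∈ S, (e.map f).IsDiag then 1 else 0 := by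
      intro S
      rw [Finset.prod_neg, Finset.prod_boole]
      congr
    simp only [h5, Finset.prod_const_one, mul_one] at h4
    rw [← h4]
    split_ifs with h
    · apply Finset.prod_eq_one
      intro e
      induction e with | _ u v
      intro he
      rw [SimpleGraph.mem_edgeFinset, SimpleGraph.mem_edgeSet] at he
      simp [h u v he]
    · push Not at h
      obtain ⟨u, v, huv, hf⟩ := h
      refine Finset.prod_eq_zero (i := s(u, v)) ?_ ?_
      · simpa using huv
      · simp [hf]
  have hcol : (numColorings G k : ℤ) =
      ∑ f : V → Fin k, if ∀ u v, G.Adj u v → f u ≠ f v then 1 else 0 := by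
    have e : G.Coloring (Fin k) ≃ {f : V → Fin k // ∀ u v, G.Adj u v → f u ≠ f v} :=
      { toFun := fun c => ⟨c, fun _ _ h => c.valid h⟩
        invFun := fun f => SimpleGraph.Coloring.mk f.1 (fun {u v} h => f.2 u v h)
        left_inv := fun _ => rfl
        right_inv := fun _ => rfl }
    rw [numColorings, Nat.card_congr e, Nat.card_eq_fintype_card, Fintype.card_subtype,
      Finset.sum_boole]
  rw [hcol, Polynomial.eval_finsetSum]
  simp only [← hprod]
  rw [Finset.sum_comm]
  refine Finset.sum_congr rfl fun S hS => ?_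
  rw [← Finset.mul_sum, ← hcount S (Finset.mem_powerset.1 hS)]
  simp

/-- The chromatic polynomial `P(G, x)`: the polynomial whose value at every positive integer `k`
is the number of proper `k`-colorings of `G`. -/
def chromaticPolynomial {V : Type*} [Fintype V] (G : SimpleGraph V) : ℤ[X] :=
  Classical.choose (exists_chromaticPolynomial G)

/-- The defining property of the chromatic polynomial. -/
theorem chromaticPolynomial_eval {V : Type*} [Fintype V] (G : SimpleGraph V) (k : ℕ)
    (hk : 1 ≤ k) : (chromaticPolynomial G).eval (k : ℤ) = numColorings G k :=
  Classical.choose_spec (exists_chromaticPolynomial G) k hk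

/-- The chromatic polynomial is the only polynomial with its defining property. -/
theorem eq_chromaticPolynomial {V : Type*} [Fintype V] (G : SimpleGraph V) (P : ℤ[X])
    (hP : ∀ k : ℕ, 1 ≤ k → P.eval (k : ℤ) = numColorings G k) : P = chromaticPolynomial G := by
  refine Polynomial.eq_of_infinite_eval_eq _ _ (Set.Infinite.mono (s := (fun n : ℕ =>
    ((n + 1 : ℕ) : ℤ)) '' Set.univ) ?_ ?_)
  · rintro _ ⟨n, -, rfl⟩
    exact (hP _ (by omega)).trans (chromaticPolynomial_eval G _ (by omega)).symm
  · refine Set.infinite_univ.image ?_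
    intro a _ b _ h
    simpa using h

/-- For `1 ≤ i ≤ n = |V|`, the number `a_i(G)` with
`P(G, x) = ∑ i, (-1) ^ (n - i) * a_i(G) * x ^ i`. -/
def chromaticCoeff {V : Type*} [Fintype V] (G : SimpleGraph V) (i : ℕ) : ℤ :=
  (-1) ^ (Fintype.card V - i) * (chromaticPolynomial G).coeff i

/-! ### Acyclic orientations -/

/-- `D` is an orientation of `G`: every edge of `G` is an arc of `D` in exactly one of its
two directions, and `D` has no other arcs. -/
def IsOrientation {V : Type*} (G : SimpleGraph V) (D : Digraph V) : Prop :=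
  (∀ u v, G.Adj u v ↔ D.Adj u v ∨ D.Adj v u) ∧ ∀ u v, D.Adj u v → ¬ D.Adj v u

/-- `D` has no directed cycle, that is, no vertex is reached from itself by a directed walk of
positive length. -/
def IsAcyclic {V : Type*} (D : Digraph V) : Prop :=
  ∀ v, ¬ Relation.TransGen D.Adj v v

/-- A source is a vertex of in-degree zero. -/
def IsSource {V : Type*} (D : Digraph V) (v : V) : Prop :=
  ∀ u, ¬ D.Adj u v

/-- `α(H, w)`: the number of acyclic orientations of `H` with `w` as the unique source. -/
def alpha {V : Type*} (H : SimpleGraph V) (w : V) : ℕ :=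
  Nat.card {D : Digraph V //
    IsOrientation H D ∧ IsAcyclic D ∧ IsSource D w ∧ ∀ u, IsSource D u → u = w}

/-! ### Ordered partitions -/

/-- An element of `OP_{i,v}(V)`: an ordered partition `(part 0, …, part (i - 1))` of the vertex
set into nonempty parts that induce connected subgraphs, with `v` in the first part, such that
the least vertex in the union of any other part and all later parts is in the former part. -/
@[ext]
structure OrderedPartition {V : Type*} [LinearOrder V] (G : SimpleGraph V) (i : ℕ) (v : V) where
  /-- The parts. -/
  part : Fin i → Finset V
  nonempty : ∀ j, (part j).Nonempty
  disjoint : ∀ j k, j ≠ k → Disjoint (part j) (part k)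
  cover : ∀ u, ∃ j, u ∈ part j
  connected : ∀ j, (G.induce (part j : Set V)).Connected
  mem_first : ∀ hi : 0 < i, v ∈ part ⟨0, hi⟩
  least_mem : ∀ j : Fin i, 0 < j.val →
    ∃ m ∈ part j, IsLeast {u | ∃ s, j ≤ s ∧ u ∈ part s} m

instance {V : Type*} [Fintype V] [LinearOrder V] (G : SimpleGraph V) (i : ℕ) (v : V) :
    Fintype (OrderedPartition G i v) :=
  @Fintype.ofFinite _ (Finite.of_injective OrderedPartition.part fun _ _ h =>
    OrderedPartition.ext h)

/-- The vertex `v`, as a vertex of the subgraph induced by the first part. -/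
def OrderedPartition.root {V : Type*} [LinearOrder V] {G : SimpleGraph V} {i : ℕ} {v : V}
    (P : OrderedPartition G i v) (hi : 0 < i) : (P.part ⟨0, hi⟩ : Set V) :=
  ⟨v, P.mem_first hi⟩

/-- The least vertex `m_j` of the `j`-th part, as a vertex of the subgraph induced by it. -/
def OrderedPartition.least {V : Type*} [LinearOrder V] {G : SimpleGraph V} {i : ℕ} {v : V}
    (P : OrderedPartition G i v) (j : Fin i) : (P.part j : Set V) :=
  ⟨(P.part j).min' (P.nonempty j), (P.part j).min'_mem (P.nonempty j)⟩

end ChromaticCoeff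

end

/-!
Write `χ_A` for the chromatic polynomial of `G[A]`. Splitting the colorings along a division of the
palette into two parts gives `χ_A(x + y) = ∑_{B ⊆ A} χ_B(x) χ_{A \ B}(y)`, and splitting them along
the color class `B` of a vertex `v ∈ A` gives `χ_A(x) = x ∑_{v ∈ B ⊆ A} χ_B(1) χ_{A \ B}(x - 1)`.
Expanding `χ_{A \ B}(-1 + x)` in the latter by the former,
`χ_A(x) = x ∑_{D ⊆ A} c_D χ_{A \ D}(x)`, where `c_D = ∑_{v ∈ B ⊆ D} χ_B(1) χ_{D \ B}(-1)`.

Since `χ_B(1)` tells whether `B` is independent, Stanley's theorem turns `χ_B(1) χ_{D \ B}(-1)`, up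
to sign, into the number of acyclic orientations of `G[D]` in which all vertices of `B` are sources,
and inclusion-exclusion over the set of sources shows that `c_D = (-1)^(|D| + 1) α(G[D], v)`. The
formula for the coefficients follows by iterating the recursion for `χ_A`. Each step may use any
vertex `v` of the set `A` that is left: `OP_{i,v}(V)` corresponds to the given vertex in the first
step and to the least vertex of `A` in the others.
-/

namespace ChromaticCoeff

open Finset

variable {V : Type*}

section Coloring

variable {κ : Type*}

theorem card_coloring (G : SimpleGraph V) (κ : Type*) [Finite κ] :
    Nat.card (G.Coloring κ) = numColorings G (Nat.card κ) :=
  Nat.card_congr (G.recolorOfEquiv (Finite.equivFin κ))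

/-- Splitting of a coloring of `G[A]` along a set `S` of colors: if `B` is the set of vertices
with colors in `S`, it consists of a coloring of `G[B]` by `S` and one of `G[A \ B]` by `Sᶜ`. -/
noncomputable def splitColoring (G : SimpleGraph V) {A B : Set V} (hB : B ⊆ A) (S : Set κ) :
    {c : (G.induce A).Coloring κ // ∀ u, c u ∈ S ↔ u.1 ∈ B} ≃
      (G.induce B).Coloring S × (G.induce (A \ B)).Coloring ↥Sᶜ where
  toFun c :=
    (.mk (fun u => ⟨c.1 ⟨u, hB u.2⟩, (c.2 _).2 u.2⟩)
      fun {u w} huw h =>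
        c.1.valid (v := ⟨u, hB u.2⟩) (w := ⟨w, hB w.2⟩) huw (congrArg Subtype.val h),
    .mk (fun u => ⟨c.1 ⟨u, u.2.1⟩, fun h => u.2.2 ((c.2 _).1 h)⟩)
      fun {u w} huw h =>
        c.1.valid (v := ⟨u, u.2.1⟩) (w := ⟨w, w.2.1⟩) huw (congrArg Subtype.val h))
  invFun p := by
    classical
    refine ⟨.mk (fun u => if h : u.1 ∈ B then (p.1 ⟨u, h⟩).1 else (p.2 ⟨u, u.2, h⟩).1) ?_, ?_⟩
    · intro u w huw h
      have hS : ∀ x y, (p.1 x).1 ≠ (p.2 y).1 := fun x y h => (p.2 y).2 (h ▸ (p.1 x).2)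
      split_ifs at h with hu hw hw
      · exact p.1.valid (v := ⟨u, hu⟩) (w := ⟨w, hw⟩) huw (Subtype.ext h)
      · exact hS _ _ h
      · exact hS _ _ h.symm
      · exact p.2.valid (v := ⟨u, u.2, hu⟩) (w := ⟨w, w.2, hw⟩) huw (Subtype.ext h)
    · intro u
      change dite _ _ _ ∈ S ↔ _
      split_ifs with hu
      · exact iff_of_true (p.1 ⟨u, hu⟩).2 hu
      · exact iff_of_false (p.2 ⟨u, u.2, hu⟩).2 hu
  left_inv c := by
    ext u
    by_cases hu : u.1 ∈ B
    exacts [dif_pos hu, dif_neg hu]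
  right_inv p := by
    ext u
    exacts [dif_pos u.2, dif_neg u.2.2]

open scoped Classical in
/-- The set of vertices of `G[A]` with colors in `S`, as a set of vertices of `G`. -/
noncomputable def colorPreimage {G : SimpleGraph V} {A : Finset V} (S : Set κ)
    (c : (G.induce (A : Set V)).Coloring κ) : Finset V :=
  A.filter fun u => ∃ h : u ∈ A, c ⟨u, h⟩ ∈ S

theorem mem_colorPreimage {G : SimpleGraph V} {A : Finset V} {S : Set κ}
    {c : (G.induce (A : Set V)).Coloring κ} {u : V} :
    u ∈ colorPreimage S c ↔ ∃ h : u ∈ A, c ⟨u, h⟩ ∈ S := by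
  simp +contextual [colorPreimage]

theorem colorPreimage_eq_iff {G : SimpleGraph V} {A B : Finset V} (hB : B ⊆ A) {S : Set κ}
    {c : (G.induce (A : Set V)).Coloring κ} :
    colorPreimage S c = B ↔ ∀ u, c u ∈ S ↔ u.1 ∈ (B : Set V) := by
  simp only [Finset.ext_iff, mem_colorPreimage, Subtype.forall, mem_coe]
  exact ⟨fun h u hu => ⟨fun hc => (h u).1 ⟨hu, hc⟩, fun hu => ((h u).2 hu).2⟩,
    fun h u => ⟨fun ⟨hu, hc⟩ => (h u hu).1 hc, fun hu => ⟨hB hu, (h u (hB hu)).2 hu⟩⟩⟩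

variable [DecidableEq V]

theorem card_colorPreimage_eq [Finite κ] (G : SimpleGraph V) {A B : Finset V} (hB : B ⊆ A)
    (S : Set κ) :
    Nat.card {c : (G.induce (A : Set V)).Coloring κ // colorPreimage S c = B} =
      numColorings (G.induce (B : Set V)) (Nat.card S) *
        numColorings (G.induce ((A \ B : Finset V) : Set V)) (Nat.card ↥Sᶜ) := by
  rw [Nat.card_congr ((Equiv.subtypeEquivRight fun _ => colorPreimage_eq_iff hB).trans
    (splitColoring G (coe_subset.2 hB) S)), Nat.card_prod, card_coloring, card_coloring, coe_sdiff]

theorem card_coloring_colorPreimage [Finite κ] (G : SimpleGraph V) (A : Finset V) (S : Set κ)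
    (q : Finset V → Prop) [DecidablePred q] :
    Nat.card {c : (G.induce (A : Set V)).Coloring κ // q (colorPreimage S c)} =
      ∑ B ∈ A.powerset with q B, numColorings (G.induce (B : Set V)) (Nat.card S) *
        numColorings (G.induce ((A \ B : Finset V) : Set V)) (Nat.card ↥Sᶜ) := by
  have preimage_subset (c : (G.induce (A : Set V)).Coloring κ) : colorPreimage S c ⊆ A :=
    fun _ hu => (mem_colorPreimage.1 hu).1
  let preimage (c : {c : (G.induce (A : Set V)).Coloring κ // q (colorPreimage S c)}) :
      ↥(A.powerset.filter q) := ⟨colorPreimage S c.1, by simp [c.2, preimage_subset]⟩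
  rw [Nat.card_congr (Equiv.sigmaFiberEquiv preimage).symm, Nat.card_sigma,
    ← sum_coe_sort (A.powerset.filter q)]
  refine sum_congr rfl fun ⟨B, hB⟩ _ => ?_
  rw [mem_filter, mem_powerset] at hB
  rw [← card_colorPreimage_eq G hB.1 S]
  exact Nat.card_congr ⟨fun c => ⟨c.1.1, Subtype.ext_iff.1 c.2⟩,
    fun c => ⟨⟨c.1, by rw [c.2]; exact hB.2⟩, Subtype.ext c.2⟩, fun _ => rfl, fun _ => rfl⟩

theorem numColorings_induce_add (G : SimpleGraph V) (A : Finset V) (k l : ℕ) :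
    numColorings (G.induce (A : Set V)) (k + l) = ∑ B ∈ A.powerset,
      numColorings (G.induce (B : Set V)) k *
        numColorings (G.induce ((A \ B : Finset V) : Set V)) l := by
  let S : Set (Fin k ⊕ Fin l) := Set.range Sum.inl
  have card_S : Nat.card S = k := by
    simpa using Nat.card_range_of_injective (Sum.inl_injective (α := Fin k) (β := Fin l))
  have card_compl : Nat.card ↥Sᶜ = l := by
    simpa [S] using Nat.card_range_of_injective (Sum.inr_injective (α := Fin k) (β := Fin l))
  have h := card_coloring_colorPreimage G A S fun _ => True
  rw [Nat.card_congr (Equiv.subtypeUnivEquiv fun _ => trivial), card_coloring, card_S, card_compl,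
    filter_true] at h
  simpa using h

theorem numColorings_induce_succ (G : SimpleGraph V) {A : Finset V} {v : V} (hv : v ∈ A) (k : ℕ) :
    numColorings (G.induce (A : Set V)) (k + 1) = (k + 1) * ∑ B ∈ A.powerset with v ∈ B,
      numColorings (G.induce (B : Set V)) 1 *
        numColorings (G.induce ((A \ B : Finset V) : Set V)) k := by
  have card_color_eq (j : Fin (k + 1)) :
      Nat.card {c : (G.induce (A : Set V)).Coloring (Fin (k + 1)) // c ⟨v, hv⟩ = j} =
        ∑ B ∈ A.powerset with v ∈ B, numColorings (G.induce (B : Set V)) 1 *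
          numColorings (G.induce ((A \ B : Finset V) : Set V)) k := by
    have card_compl : Nat.card ↥({j}ᶜ : Set (Fin (k + 1))) = k := by
      rw [Nat.card_coe_set_eq, Set.ncard_compl, Set.ncard_singleton, Nat.card_fin,
        Nat.add_sub_cancel]
    have h := card_coloring_colorPreimage G A {j} fun B => v ∈ B
    rw [card_compl, Nat.card_coe_set_eq, Set.ncard_singleton] at h
    rw [← h]
    exact Nat.card_congr (Equiv.subtypeEquivRight fun c => by simp [mem_colorPreimage, hv])
  rw [numColorings, Nat.card_congr (Equiv.sigmaFiberEquiv
    fun c : (G.induce (A : Set V)).Coloring (Fin (k + 1)) => c ⟨v, hv⟩).symm, Nat.card_sigma,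
    sum_congr rfl fun j _ => card_color_eq j]
  simp

end Coloring

section ChromaticPolynomial

theorem polynomial_eq_of_eval_nat {P Q : ℤ[X]}
    (h : ∀ k : ℕ, 1 ≤ k → P.eval (k : ℤ) = Q.eval (k : ℤ)) : P = Q := by
  refine eq_of_infinite_eval_eq _ _ (Set.Infinite.mono (s := (fun k : ℕ => (k : ℤ)) '' Set.Ici 1)
    ?_ ((Set.Ici_infinite 1).image Nat.cast_injective.injOn))
  rintro _ ⟨k, hk, rfl⟩
  exact h k hk

/-- The chromatic polynomial of the subgraph of `G` induced by `A`. -/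
noncomputable def chi (G : SimpleGraph V) (A : Finset V) : ℤ[X] :=
  chromaticPolynomial (G.induce (A : Set V))

theorem chi_eval (G : SimpleGraph V) (A : Finset V) {k : ℕ} (hk : 1 ≤ k) :
    (chi G A).eval (k : ℤ) = numColorings (G.induce (A : Set V)) k :=
  chromaticPolynomial_eval _ k hk

theorem chi_univ [Fintype V] (G : SimpleGraph V) : chi G univ = chromaticPolynomial G := by
  refine eq_chromaticPolynomial G _ fun k hk => ?_
  rw [chi_eval G _ hk, coe_univ, numColorings, numColorings,
    Nat.card_congr (SimpleGraph.coloringCongr G.induceUnivIso (Equiv.refl _))]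

theorem chi_empty (G : SimpleGraph V) : chi G ∅ = 1 := by
  refine polynomial_eq_of_eval_nat fun k hk => ?_
  rw [chi_eval G _ hk, eval_one, numColorings, Nat.cast_eq_one, Nat.card_eq_one_iff_unique]
  exact ⟨⟨fun c d => RelHom.ext fun u => absurd u.2 (notMem_empty _)⟩,
    ⟨.mk (fun u => absurd u.2 (notMem_empty _)) fun {u} => absurd u.2 (notMem_empty _)⟩⟩

open scoped Classical in
theorem chi_eval_one (G : SimpleGraph V) (A : Finset V) :
    (chi G A).eval 1 = if G.IsIndepSet A then 1 else 0 := by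
  rw [← Nat.cast_one (R := ℤ), chi_eval G A le_rfl, numColorings]
  split_ifs with indep
  · have : Unique ((G.induce (A : Set V)).Coloring (Fin 1)) :=
      ⟨⟨.mk (fun _ => 0) fun {u w} huw => absurd huw (indep u.2 w.2 (Subtype.coe_ne_coe.2 huw.ne))⟩,
        fun c => RelHom.ext fun _ => Subsingleton.elim _ _⟩
    simp
  · have : IsEmpty ((G.induce (A : Set V)).Coloring (Fin 1)) :=
      ⟨fun c => indep fun u hu w hw _ huw =>
        c.valid (v := ⟨u, hu⟩) (w := ⟨w, hw⟩) huw (Subsingleton.elim _ _)⟩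
    simp

variable [DecidableEq V]

theorem chi_eval_add (G : SimpleGraph V) (A : Finset V) (x y : ℤ) :
    (chi G A).eval (x + y) = ∑ B ∈ A.powerset, (chi G B).eval x * (chi G (A \ B)).eval y := by
  have comp_add_nat (k : ℕ) (hk : 1 ≤ k) : (chi G A).comp (X + C (k : ℤ)) =
      ∑ B ∈ A.powerset, chi G B * C ((chi G (A \ B)).eval (k : ℤ)) := by
    refine polynomial_eq_of_eval_nat fun l hl => ?_
    simp only [eval_comp, eval_add, eval_X, eval_C, eval_finsetSum, eval_mul]
    rw [← Nat.cast_add, chi_eval G A (by omega), numColorings_induce_add]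
    simp only [chi_eval G _ hl, chi_eval G _ hk, Nat.cast_sum, Nat.cast_mul]
  have comp_add : (chi G A).comp (C x + X) =
      ∑ B ∈ A.powerset, C ((chi G B).eval x) * chi G (A \ B) :=
    polynomial_eq_of_eval_nat fun k hk => by
      simpa [eval_finsetSum] using congrArg (eval x) (comp_add_nat k hk)
  simpa [eval_finsetSum] using congrArg (eval y) comp_add

theorem chi_eval_eq_mul_sum (G : SimpleGraph V) {A : Finset V} {v : V} (hv : v ∈ A) (x : ℤ) :
    (chi G A).eval x =
      x * ∑ B ∈ A.powerset with v ∈ B, (chi G B).eval 1 * (chi G (A \ B)).eval (x - 1) := by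
  have comp_add_one : (chi G A).comp (X + 1) = (X + 1) * ∑ B ∈ A.powerset with v ∈ B,
      C ((chi G B).eval 1) * chi G (A \ B) := by
    refine polynomial_eq_of_eval_nat fun k hk => ?_
    simp only [eval_comp, eval_add, eval_X, eval_C, eval_finsetSum, eval_mul, eval_one]
    rw [← Nat.cast_one (R := ℤ), ← Nat.cast_add, chi_eval G A (by omega),
      numColorings_induce_succ G hv]
    simp only [chi_eval G _ hk, chi_eval G _ le_rfl, Nat.cast_sum, Nat.cast_mul, Nat.cast_add]
  simpa [eval_finsetSum] using congrArg (eval (x - 1)) comp_add_one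

theorem chi_eval_zero (G : SimpleGraph V) (A : Finset V) :
    (chi G A).eval 0 = if A = ∅ then 1 else 0 := by
  split_ifs with hA
  · rw [hA, chi_empty, eval_one]
  · obtain ⟨v, hv⟩ := nonempty_iff_ne_empty.2 hA
    rw [chi_eval_eq_mul_sum G hv, zero_mul]

end ChromaticPolynomial

section PowersetSums

variable [DecidableEq V]

theorem sum_powerset_sum_powerset_sdiff {M : Type*} [AddCommMonoid M] (A : Finset V)
    (q : Finset V → Prop) [DecidablePred q] (f : Finset V → Finset V → M) :
    ∑ B ∈ A.powerset with q B, ∑ E ∈ (A \ B).powerset, f B E =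
      ∑ D ∈ A.powerset, ∑ B ∈ D.powerset with q B, f B (D \ B) := calc
  _ = ∑ B ∈ A.powerset with q B, ∑ D ∈ Icc B A, f B (D \ B) := by
    refine sum_congr rfl fun B hB => ?_
    rw [mem_filter, mem_powerset] at hB
    rw [Icc_eq_image_powerset hB.1, sum_image fun E hE F hF h => by
      rw [← union_sdiff_cancel_left (disjoint_of_subset_right (mem_powerset.1 hE) disjoint_sdiff),
        h, union_sdiff_cancel_left (disjoint_of_subset_right (mem_powerset.1 hF) disjoint_sdiff)]]
    refine sum_congr rfl fun E hE => ?_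
    rw [union_sdiff_cancel_left (disjoint_of_subset_right (mem_powerset.1 hE) disjoint_sdiff)]
  _ = _ := sum_comm' fun B D => by
    simp only [mem_filter, mem_powerset, mem_Icc]
    exact ⟨fun h => ⟨⟨h.2.1, h.1.2⟩, h.2.2⟩, fun h => ⟨⟨h.1.1.trans h.2, h.1.2⟩, h.1.1, h.2⟩⟩

theorem eq_of_sum_powerset_mul_eq {R : Type*} [Ring R] {f g h : Finset V → R} (hf : f ∅ = 1)
    (sum_eq : ∀ A : Finset V,
      ∑ B ∈ A.powerset, f B * g (A \ B) = ∑ B ∈ A.powerset, f B * h (A \ B)) : g = h := by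
  funext A
  induction A using Finset.strongInduction with | H A ih =>
  have sum_erase_eq : ∑ B ∈ A.powerset.erase ∅, f B * g (A \ B) =
      ∑ B ∈ A.powerset.erase ∅, f B * h (A \ B) := by
    refine sum_congr rfl fun B hB => ?_
    rw [mem_erase, mem_powerset] at hB
    rw [ih _ (sdiff_ssubset hB.2 (nonempty_iff_ne_empty.2 hB.1))]
  have := sum_eq A
  rw [← add_sum_erase _ _ (empty_mem_powerset A), ← add_sum_erase _ _ (empty_mem_powerset A),
    sum_erase_eq, add_left_inj, hf, one_mul, one_mul, sdiff_empty] at this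
  exact this

theorem sum_powerset_mem_neg_one_pow_card (S : Finset V) (v : V) :
    ∑ B ∈ S.powerset with v ∈ B, (-1 : ℤ) ^ #B = if S = {v} then -1 else 0 := by
  by_cases hv : v ∈ S
  · obtain ⟨T, hvT, rfl⟩ : ∃ T, v ∉ T ∧ insert v T = S := ⟨_, notMem_erase v S, insert_erase hv⟩
    have notMem_subset : ∀ B ∈ T.powerset, v ∉ B := fun B hB h => hvT (mem_powerset.1 hB h)
    have insert_eq_singleton : insert v T = {v} ↔ T = ∅ :=
      ⟨fun h => by rw [← erase_insert hvT, h, erase_singleton], by rintro rfl; rfl⟩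
    calc ∑ B ∈ (insert v T).powerset with v ∈ B, (-1 : ℤ) ^ #B
      _ = -∑ B ∈ T.powerset, (-1 : ℤ) ^ #B := by
        rw [sum_filter, sum_powerset_insert hvT, sum_congr rfl fun B hB =>
          if_neg (notMem_subset B hB), sum_const_zero, zero_add, ← sum_neg_distrib]
        refine sum_congr rfl fun B hB => ?_
        rw [if_pos (mem_insert_self v B), card_insert_of_notMem (notMem_subset B hB), pow_succ,
          mul_neg_one]
      _ = _ := by
        rw [sum_powerset_neg_one_pow_card]
        simp only [insert_eq_singleton, neg_ite, neg_zero]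
  · rw [if_neg (by rintro rfl; exact hv (mem_singleton_self v)),
      filter_false_of_mem fun B hB h => hv (mem_powerset.1 hB h), sum_empty]

end PowersetSums

section AcyclicOrientations

/-- The digraph on `W` whose arcs are the pairs mapped by `f` to arcs of `D`. -/
def comapDigraph {W W' : Type*} (f : W → W') (D : Digraph W') : Digraph W where
  Adj u w := D.Adj (f u) (f w)

theorem IsOrientation.comap {W W' : Type*} {H : SimpleGraph W'} {D : Digraph W'}
    (hD : IsOrientation H D) (f : W → W') : IsOrientation (H.comap f) (comapDigraph f D) :=
  ⟨fun _ _ => hD.1 _ _, fun _ _ => hD.2 _ _⟩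

theorem IsAcyclic.comap {W W' : Type*} {D : Digraph W'} (hD : IsAcyclic D) (f : W → W') :
    IsAcyclic (comapDigraph f D) :=
  fun v hv => hD (f v) (hv.lift f fun _ _ h => h)

theorem wellFounded_of_isAcyclic {W : Type*} [Finite W] {D : Digraph W} (hD : IsAcyclic D) :
    WellFounded D.Adj :=
  have : Std.Irrefl (Relation.TransGen D.Adj) := ⟨hD⟩
  Subrelation.wf Relation.TransGen.single
    (Finite.wellFounded_of_trans_of_irrefl (Relation.TransGen D.Adj))

theorem connected_of_alpha_ne_zero {W : Type*} [Finite W] {H : SimpleGraph W} {w : W}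
    (h : alpha H w ≠ 0) : H.Connected := by
  obtain ⟨⟨D, orientation, acyclic, -, eq_of_isSource⟩⟩ := (Nat.card_ne_zero.1 h).1
  have reachable (u : W) : H.Reachable u w := by
    induction u using (wellFounded_of_isAcyclic acyclic).induction with | _ u ih =>
    by_cases hu : IsSource D u
    · rw [eq_of_isSource u hu]
    · obtain ⟨x, hxu⟩ : ∃ x, D.Adj x u := by simpa [IsSource] using hu
      exact ((orientation.1 x u).2 (.inl hxu)).symm.reachable.trans (ih x hxu)
  exact (SimpleGraph.connected_iff_exists_forall_reachable H).2 ⟨w, fun u => (reachable u).symm⟩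

section AddSources

variable {A B : Set V}

/-- The digraph on `A` obtained from a digraph `D` on `A \ B` by directing the edges of `G` between
`B` and `A \ B` away from `B`. -/
def addSources (G : SimpleGraph V) (D : Digraph ↥(A \ B)) : Digraph A where
  Adj u w := (∃ (hu : u.1 ∉ B) (hw : w.1 ∉ B), D.Adj ⟨u, u.2, hu⟩ ⟨w, w.2, hw⟩) ∨
    u.1 ∈ B ∧ w.1 ∉ B ∧ G.Adj u w

theorem notMem_of_addSources_adj {G : SimpleGraph V} {D : Digraph ↥(A \ B)} {u w : A}
    (h : (addSources G D).Adj u w) : w.1 ∉ B :=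
  h.elim (fun ⟨_, hw, _⟩ => hw) fun h => h.2.1

theorem comap_addSources (G : SimpleGraph V) (D : Digraph ↥(A \ B)) :
    comapDigraph (Set.inclusion Set.sdiff_subset) (addSources G D) = D := by
  ext u w
  simp [comapDigraph, addSources, u.2.2, w.2.2]

theorem addSources_comap {G : SimpleGraph V} {D : Digraph A} (hD : IsOrientation (G.induce A) D)
    (hB : ∀ u : A, u.1 ∈ B → IsSource D u) :
    addSources G (comapDigraph (Set.inclusion (Set.sdiff_subset (t := B))) D) = D := by
  ext u w
  constructor
  · rintro (⟨_, _, h⟩ | ⟨hu, -, h⟩)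
    · exact h
    · exact ((hD.1 u w).1 h).resolve_right (hB u hu w)
  · intro h
    have hw : w.1 ∉ B := fun hw => hB w hw u h
    by_cases hu : u.1 ∈ B
    · exact .inr ⟨hu, hw, (hD.1 u w).2 (.inl h)⟩
    · exact .inl ⟨hu, hw, h⟩

theorem IsOrientation.addSources {G : SimpleGraph V} {D : Digraph ↥(A \ B)}
    (hD : IsOrientation (G.induce (A \ B)) D) (hB : G.IsIndepSet B) :
    IsOrientation (G.induce A) (addSources G D) := by
  refine ⟨fun u w => ⟨fun h => ?_, ?_⟩, ?_⟩
  · by_cases hu : u.1 ∈ B <;> by_cases hw : w.1 ∈ B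
    · exact absurd h (hB hu hw (Subtype.coe_ne_coe.2 h.ne))
    · exact .inl (.inr ⟨hu, hw, h⟩)
    · exact .inr (.inr ⟨hw, hu, h.symm⟩)
    · exact ((hD.1 ⟨u, u.2, hu⟩ ⟨w, w.2, hw⟩).1 h).imp (fun h => .inl ⟨hu, hw, h⟩)
        fun h => .inl ⟨hw, hu, h⟩
  · rintro ((⟨_, _, h⟩ | ⟨-, -, h⟩) | (⟨_, _, h⟩ | ⟨-, -, h⟩))
    exacts [(hD.1 _ _).2 (.inl h), h, (hD.1 _ _).2 (.inr h), h.symm]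
  · intro u w h h'
    have hu := notMem_of_addSources_adj h'
    have hw := notMem_of_addSources_adj h
    obtain ⟨_, _, h⟩ := h.resolve_right fun h => hu h.1
    obtain ⟨_, _, h'⟩ := h'.resolve_right fun h => hw h.1
    exact hD.2 _ _ h h'

theorem IsAcyclic.addSources {D : Digraph ↥(A \ B)} (hD : IsAcyclic D) (G : SimpleGraph V) :
    IsAcyclic (addSources G D) := by
  have transGen_of_notMem {u w : A} (hu : u.1 ∉ B)
      (h : Relation.TransGen (ChromaticCoeff.addSources G D).Adj u w) :
      ∃ hw : w.1 ∉ B, Relation.TransGen D.Adj ⟨u, u.2, hu⟩ ⟨w, w.2, hw⟩ := by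
    induction h with
    | single h =>
      obtain ⟨_, hw, h⟩ := h.resolve_right fun h => hu h.1
      exact ⟨hw, .single h⟩
    | tail _ h ih =>
      obtain ⟨hx, hux⟩ := ih
      obtain ⟨_, hw, h⟩ := h.resolve_right fun h => hx h.1
      exact ⟨hw, hux.tail h⟩
  intro u hu
  obtain ⟨_, _, h⟩ := Relation.TransGen.tail'_iff.1 hu
  obtain ⟨_, h⟩ := transGen_of_notMem (notMem_of_addSources_adj h) hu
  exact hD _ h

/-- Deleting an independent set `B` of sources from the acyclic orientations of `G[A]`. -/
def deleteSources {G : SimpleGraph V} (hB : G.IsIndepSet B) :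
    {D : Digraph A // (IsOrientation (G.induce A) D ∧ IsAcyclic D) ∧
      ∀ u : A, u.1 ∈ B → IsSource D u} ≃
      {D : Digraph ↥(A \ B) // IsOrientation (G.induce (A \ B)) D ∧ IsAcyclic D} where
  toFun D := ⟨comapDigraph (Set.inclusion Set.sdiff_subset) D.1,
    D.2.1.1.comap (Set.inclusion Set.sdiff_subset), D.2.1.2.comap _⟩
  invFun D := ⟨addSources G D.1, ⟨D.2.1.addSources hB, D.2.2.addSources G⟩,
    fun _ hu _ h => notMem_of_addSources_adj h hu⟩
  left_inv D := Subtype.ext (addSources_comap D.2.1.1 D.2.2)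
  right_inv D := Subtype.ext (comap_addSources G D.1)

end AddSources

variable {A B : Finset V}

open scoped Classical in
/-- The acyclic orientations of `G[A]`. -/
noncomputable def acyclicOrientations (G : SimpleGraph V) (A : Finset V) :
    Finset (Digraph (A : Set V)) :=
  {D | IsOrientation (G.induce (A : Set V)) D ∧ IsAcyclic D}

theorem mem_acyclicOrientations {G : SimpleGraph V} {D : Digraph (A : Set V)} :
    D ∈ acyclicOrientations G A ↔ IsOrientation (G.induce (A : Set V)) D ∧ IsAcyclic D := by
  simp [acyclicOrientations]

theorem card_acyclicOrientations (G : SimpleGraph V) (A : Finset V) :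
    #(acyclicOrientations G A) =
      Nat.card {D : Digraph (A : Set V) // IsOrientation (G.induce (A : Set V)) D ∧ IsAcyclic D} :=
  (Nat.subtype_card _ fun _ => mem_acyclicOrientations).symm

theorem card_acyclicOrientations_empty (G : SimpleGraph V) : #(acyclicOrientations G ∅) = 1 := by
  rw [card_acyclicOrientations, Nat.card_eq_one_iff_unique]
  have : IsEmpty ((∅ : Finset V) : Set V) := ⟨fun u => notMem_empty _ u.2⟩
  exact ⟨⟨fun D D' => Subtype.ext (Digraph.ext (Subsingleton.elim _ _))⟩,
    ⟨⟨⟨fun _ _ => False⟩, ⟨isEmptyElim, isEmptyElim⟩, isEmptyElim⟩⟩⟩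

open scoped Classical in
/-- The sources of a digraph on `A`, as a set of vertices of the ambient graph. -/
noncomputable def sources (D : Digraph (A : Set V)) : Finset V :=
  (univ.filter (IsSource D)).map (.subtype _)

theorem mem_sources {D : Digraph (A : Set V)} {u : V} :
    u ∈ sources D ↔ ∃ h : u ∈ A, IsSource D ⟨u, h⟩ := by
  simp [sources]

theorem sources_subset (D : Digraph (A : Set V)) : sources D ⊆ A :=
  fun _ hu => (mem_sources.1 hu).1

theorem subset_sources_iff (hB : B ⊆ A) {D : Digraph (A : Set V)} :
    B ⊆ sources D ↔ ∀ u : (A : Set V), u.1 ∈ (B : Set V) → IsSource D u :=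
  ⟨fun h _ hu => (mem_sources.1 (h hu)).2, fun h u hu => mem_sources.2 ⟨hB hu, h ⟨u, hB hu⟩ hu⟩⟩

theorem sources_eq_singleton_iff {D : Digraph (A : Set V)} {v : V} (hv : v ∈ A) :
    sources D = {v} ↔ IsSource D ⟨v, hv⟩ ∧ ∀ u, IsSource D u → u = ⟨v, hv⟩ := by
  simp only [eq_singleton_iff_unique_mem, mem_sources, hv, Subtype.forall, Subtype.mk.injEq,
    forall_exists_index, exists_true_left, mem_coe]

theorem sources_eq_empty_iff {D : Digraph (A : Set V)} (hD : IsAcyclic D) :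
    sources D = ∅ ↔ A = ∅ := by
  refine ⟨fun h => ?_, fun h => subset_empty.1 (h ▸ sources_subset D)⟩
  by_contra hA
  obtain ⟨u, hu⟩ := nonempty_iff_ne_empty.2 hA
  obtain ⟨m, -, hm⟩ := (wellFounded_of_isAcyclic hD).has_min Set.univ ⟨⟨u, hu⟩, trivial⟩
  exact notMem_empty m.1 (h ▸ mem_sources.2 ⟨m.2, fun w => hm w trivial⟩)

theorem isIndepSet_of_subset_sources {G : SimpleGraph V} {D : Digraph (A : Set V)}
    (hD : IsOrientation (G.induce (A : Set V)) D) (hB : B ⊆ sources D) : G.IsIndepSet B := by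
  intro u hu w hw _ huw
  obtain ⟨hu, source_u⟩ := mem_sources.1 (hB hu)
  obtain ⟨hw, source_w⟩ := mem_sources.1 (hB hw)
  exact ((hD.1 ⟨u, hu⟩ ⟨w, hw⟩).1 huw).elim (source_w _) (source_u _)

theorem card_filter_subset_sources [DecidableEq V] (G : SimpleGraph V) (hB : B ⊆ A) :
    (#{D ∈ acyclicOrientations G A | B ⊆ sources D} : ℤ) =
      (chi G B).eval 1 * #(acyclicOrientations G (A \ B)) := by
  rw [chi_eval_one]
  split_ifs with indep
  · rw [one_mul, card_acyclicOrientations, coe_sdiff, ← Nat.card_congr (deleteSources indep),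
      Nat.cast_inj]
    exact (Nat.subtype_card _ fun D => by
      rw [mem_filter, mem_acyclicOrientations, subset_sources_iff hB]).symm
  · rw [zero_mul, Nat.cast_eq_zero, card_eq_zero, filter_eq_empty_iff]
    exact fun D hD hB => indep (isIndepSet_of_subset_sources (mem_acyclicOrientations.1 hD).1 hB)

theorem sum_powerset_chi_eval_one_mul [DecidableEq V] (G : SimpleGraph V) (A : Finset V)
    (q : Finset V → Prop) [DecidablePred q] :
    ∑ B ∈ A.powerset with q B,
        (chi G B).eval 1 * ((-1) ^ #(A \ B) * (#(acyclicOrientations G (A \ B)) : ℤ)) =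
      (-1) ^ #A * ∑ D ∈ acyclicOrientations G A, ∑ B ∈ (sources D).powerset with q B,
        (-1) ^ #B := by
  have neg_one_pow_card_sdiff {B : Finset V} (hB : B ⊆ A) :
      (-1 : ℤ) ^ #(A \ B) = (-1) ^ #A * (-1) ^ #B := by
    rw [← card_sdiff_add_card_eq_card hB, pow_add, mul_assoc, ← mul_pow, neg_one_mul, neg_neg,
      one_pow, mul_one]
  calc
    _ = ∑ B ∈ A.powerset with q B, ∑ D ∈ acyclicOrientations G A with B ⊆ sources D,
        (-1 : ℤ) ^ #A * (-1) ^ #B := by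
      refine sum_congr rfl fun B hB => ?_
      rw [mem_filter, mem_powerset] at hB
      rw [sum_const, nsmul_eq_mul, card_filter_subset_sources G hB.1,
        neg_one_pow_card_sdiff hB.1]
      ring
    _ = ∑ D ∈ acyclicOrientations G A, ∑ B ∈ (sources D).powerset with q B,
        (-1 : ℤ) ^ #A * (-1) ^ #B := sum_comm' fun B D => by
      simp only [mem_filter, mem_powerset]
      exact ⟨fun ⟨⟨_, hq⟩, hD, hB⟩ => ⟨⟨hB, hq⟩, hD⟩,
        fun ⟨⟨hB, hq⟩, hD⟩ => ⟨⟨hB.trans (sources_subset D), hq⟩, hD, hB⟩⟩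
    _ = _ := by simp only [mul_sum]

/-- Stanley's theorem. -/
theorem chi_eval_neg_one (G : SimpleGraph V) (A : Finset V) :
    (chi G A).eval (-1) = (-1) ^ #A * #(acyclicOrientations G A) := by
  classical
  have h := eq_of_sum_powerset_mul_eq (f := fun B => (chi G B).eval 1)
    (g := fun A => (chi G A).eval (-1)) (h := fun A => (-1) ^ #A * #(acyclicOrientations G A))
    (by rw [chi_empty, eval_one]) fun A => ?_
  · exact congrFun h A
  have sum_sources : ∑ D ∈ acyclicOrientations G A, ∑ B ∈ (sources D).powerset, (-1 : ℤ) ^ #B =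
      ∑ D ∈ acyclicOrientations G A, if A = ∅ then 1 else 0 := by
    refine sum_congr rfl fun D hD => ?_
    simp only [sum_powerset_neg_one_pow_card,
      sources_eq_empty_iff (mem_acyclicOrientations.1 hD).2]
  have inclusion_exclusion := sum_powerset_chi_eval_one_mul G A fun _ => True
  simp only [filter_true] at inclusion_exclusion
  rw [← chi_eval_add, add_neg_cancel, chi_eval_zero, inclusion_exclusion, sum_sources]
  split_ifs with hA
  · rw [hA, sum_const, card_acyclicOrientations_empty, card_empty, pow_zero, one_smul, one_mul]
  · simp

/-- The number of acyclic orientations of `G[A]` with `v` as the unique source, extended by `0` to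
the vertices `v` outside `A`. -/
noncomputable def alphaOn [DecidableEq V] (G : SimpleGraph V) (A : Finset V) (v : V) : ℕ :=
  if h : v ∈ A then alpha (G.induce (A : Set V)) ⟨v, h⟩ else 0

theorem alphaOn_eq_card [DecidableEq V] (G : SimpleGraph V) (A : Finset V) (v : V) :
    alphaOn G A v = #{D ∈ acyclicOrientations G A | sources D = {v}} := by
  rw [alphaOn]
  split_ifs with hv
  · exact Nat.subtype_card _ fun D => by
      rw [mem_filter, mem_acyclicOrientations, sources_eq_singleton_iff hv, and_assoc]
  · refine (card_eq_zero.2 (filter_eq_empty_iff.2 fun D _ hD => hv ?_)).symm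
    exact sources_subset D (hD ▸ mem_singleton_self v)

theorem mem_and_connected_of_alphaOn_ne_zero [DecidableEq V] {G : SimpleGraph V} {A : Finset V}
    {v : V} (h : alphaOn G A v ≠ 0) : v ∈ A ∧ (G.induce (A : Set V)).Connected := by
  rw [alphaOn] at h
  split_ifs at h with hv
  · exact ⟨hv, connected_of_alpha_ne_zero h⟩
  · exact absurd rfl h

theorem sum_powerset_chi_eval_one_mul_chi_eval_neg_one [DecidableEq V] (G : SimpleGraph V)
    (A : Finset V) (v : V) :
    ∑ B ∈ A.powerset with v ∈ B, (chi G B).eval 1 * (chi G (A \ B)).eval (-1) =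
      (-1) ^ (#A + 1) * alphaOn G A v := by
  simp only [chi_eval_neg_one, sum_powerset_chi_eval_one_mul, sum_powerset_mem_neg_one_pow_card,
    alphaOn_eq_card]
  rw [← sum_filter, sum_const, nsmul_eq_mul, pow_succ, mul_assoc, mul_comm (-1 : ℤ)]

end AcyclicOrientations

theorem chi_eq_X_mul_sum [DecidableEq V] (G : SimpleGraph V) {A : Finset V} {v : V} (hv : v ∈ A) :
    chi G A = X * ∑ D ∈ A.powerset, C ((-1) ^ (#D + 1) * (alphaOn G D v : ℤ)) * chi G (A \ D) := by
  refine polynomial_eq_of_eval_nat fun k _ => ?_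
  rw [chi_eval_eq_mul_sum G hv, eval_mul, eval_X, eval_finsetSum]
  congr 1
  calc ∑ B ∈ A.powerset with v ∈ B, (chi G B).eval 1 * (chi G (A \ B)).eval ((k : ℤ) - 1)
    _ = ∑ B ∈ A.powerset with v ∈ B, ∑ E ∈ (A \ B).powerset,
        (chi G B).eval 1 * (chi G E).eval (-1) * (chi G (A \ (B ∪ E))).eval (k : ℤ) := by
      simp only [sub_eq_neg_add, chi_eval_add, mul_sum, mul_assoc, sdiff_sdiff_left, sup_eq_union]
    _ = ∑ D ∈ A.powerset, (∑ B ∈ D.powerset with v ∈ B,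
        (chi G B).eval 1 * (chi G (D \ B)).eval (-1)) * (chi G (A \ D)).eval (k : ℤ) := by
      rw [sum_powerset_sum_powerset_sdiff]
      refine sum_congr rfl fun D _ => ?_
      rw [sum_mul]
      refine sum_congr rfl fun B hB => ?_
      rw [mem_filter, mem_powerset] at hB
      rw [union_sdiff_of_subset hB.1]
    _ = _ := by
      simp only [sum_powerset_chi_eval_one_mul_chi_eval_neg_one, eval_mul, eval_C]

section RootedPartitions

variable [DecidableEq V] {i : ℕ}

/-- The union `f j ∪ f (j + 1) ∪ ⋯` of the `j`-th set and all later ones. -/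
def tailUnion (f : Fin i → Finset V) (j : Fin i) : Finset V :=
  (Ici j).biUnion f

theorem mem_tailUnion {f : Fin i → Finset V} {j : Fin i} {u : V} :
    u ∈ tailUnion f j ↔ ∃ s, j ≤ s ∧ u ∈ f s := by
  simp [tailUnion]

theorem subset_tailUnion (f : Fin i → Finset V) (j : Fin i) : f j ⊆ tailUnion f j :=
  subset_biUnion_of_mem f (mem_Ici.2 le_rfl)

theorem tailUnion_of_val_eq_zero (f : Fin i → Finset V) {j : Fin i} (hj : j.val = 0) :
    tailUnion f j = univ.biUnion f := by
  ext u
  simp [mem_tailUnion, Fin.le_def, hj]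

theorem tailUnion_cons_succ (D : Finset V) (g : Fin i → Finset V) (j : Fin i) :
    tailUnion (Fin.cons D g : Fin (i + 1) → Finset V) j.succ = tailUnion g j := by
  ext u
  simp [mem_tailUnion, Fin.exists_fin_succ]

theorem biUnion_cons (D : Finset V) (g : Fin i → Finset V) :
    univ.biUnion (Fin.cons D g : Fin (i + 1) → Finset V) = D ∪ univ.biUnion g := by
  ext u
  simp [Fin.exists_fin_succ]

/-- The sequence `f` is an ordered partition of `A` into parts that induce connected subgraphs,
such that each part contains the vertex that `root` selects from the union of this part and all
later ones. -/
structure IsRootedPartition (G : SimpleGraph V) (root : Finset V → V) (A : Finset V)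
    (f : Fin i → Finset V) : Prop where
  connected : ∀ j, (G.induce (f j : Set V)).Connected
  disjoint : ∀ j k, j ≠ k → Disjoint (f j) (f k)
  biUnion_eq : univ.biUnion f = A
  root_mem : ∀ j, root (tailUnion f j) ∈ f j

theorem isRootedPartition_zero_iff {G : SimpleGraph V} {root : Finset V → V} {A : Finset V}
    {f : Fin 0 → Finset V} : IsRootedPartition G root A f ↔ A = ∅ :=
  ⟨fun h => by rw [← h.biUnion_eq, univ_eq_empty, biUnion_empty],
    fun h => ⟨(·.elim0), (·.elim0), by rw [h, univ_eq_empty, biUnion_empty], (·.elim0)⟩⟩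

theorem isRootedPartition_cons_iff {G : SimpleGraph V} {root : Finset V → V} {A D : Finset V}
    {g : Fin i → Finset V} :
    IsRootedPartition G root A (Fin.cons D g : Fin (i + 1) → Finset V) ↔
      ((G.induce (D : Set V)).Connected ∧ D ⊆ A ∧ root A ∈ D) ∧
        IsRootedPartition G root (A \ D) g := by
  have tailUnion_zero : tailUnion (Fin.cons D g : Fin (i + 1) → Finset V) 0 =
      D ∪ univ.biUnion g := by rw [tailUnion_of_val_eq_zero _ rfl, biUnion_cons]
  constructor
  · rintro ⟨connected, disjoint, cover, root_mem⟩
    rw [biUnion_cons] at cover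
    have disjoint_tail : Disjoint D (univ.biUnion g) :=
      (disjoint_biUnion_right _ _ _).2 fun j _ => disjoint 0 j.succ (Fin.succ_ne_zero j).symm
    refine ⟨⟨connected 0, cover ▸ subset_union_left, ?_⟩, fun j => connected j.succ,
      fun j k hjk => disjoint j.succ k.succ (Fin.succ_injective _ |>.ne hjk), ?_, fun j => ?_⟩
    · simpa only [tailUnion_zero, cover, Fin.cons_zero] using root_mem 0
    · rw [← cover, union_sdiff_cancel_left disjoint_tail]
    · simpa only [tailUnion_cons_succ, Fin.cons_succ] using root_mem j.succ
  · rintro ⟨⟨connected_D, D_subset, root_mem_D⟩, connected, disjoint, cover, root_mem⟩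
    have disjoint_D (j : Fin i) : Disjoint D (g j) :=
      disjoint_of_subset_right (subset_biUnion_of_mem g (mem_univ j)) (cover ▸ disjoint_sdiff)
    have cover_cons : D ∪ univ.biUnion g = A := by rw [cover, union_sdiff_of_subset D_subset]
    refine ⟨Fin.cases connected_D connected, Fin.cases (Fin.cases (absurd rfl) fun k _ =>
      disjoint_D k) fun j => Fin.cases (fun _ => (disjoint_D j).symm) fun k hjk =>
      disjoint j k (ne_of_apply_ne Fin.succ hjk), by rw [biUnion_cons, cover_cons],
      Fin.cases ?_ fun j => ?_⟩
    · simpa only [tailUnion_zero, cover_cons, Fin.cons_zero] using root_mem_D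
    · simpa only [tailUnion_cons_succ, Fin.cons_succ] using root_mem j

variable [Fintype V]

open scoped Classical in
/-- The sum over the rooted partitions of `A` into `i` parts of the products of the numbers of
acyclic orientations of the parts with the selected vertex as the unique source. -/
noncomputable def rootedPartitionSum (G : SimpleGraph V) (root : Finset V → V) (i : ℕ)
    (A : Finset V) : ℕ :=
  ∑ f : Fin i → Finset V with IsRootedPartition G root A f,
    ∏ j, alphaOn G (f j) (root (tailUnion f j))

theorem rootedPartitionSum_zero (G : SimpleGraph V) (root : Finset V → V) (A : Finset V) :
    rootedPartitionSum G root 0 A = if A = ∅ then 1 else 0 := by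
  simp only [rootedPartitionSum, isRootedPartition_zero_iff]
  split_ifs with hA <;> simp [hA]

theorem rootedPartitionSum_succ (G : SimpleGraph V) (root : Finset V → V) (i : ℕ)
    (A : Finset V) : rootedPartitionSum G root (i + 1) A =
      ∑ D ∈ A.powerset, alphaOn G D (root A) * rootedPartitionSum G root i (A \ D) := by
  classical
  let IsFirstPart (D : Finset V) : Prop :=
    (G.induce (D : Set V)).Connected ∧ D ⊆ A ∧ root A ∈ D
  calc rootedPartitionSum G root (i + 1) A
    _ = ∑ D : Finset V, ∑ g : Fin i → Finset V,
        if IsFirstPart D ∧ IsRootedPartition G root (A \ D) g then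
          alphaOn G D (root A) * ∏ j, alphaOn G (g j) (root (tailUnion g j)) else 0 := by
      rw [rootedPartitionSum, sum_filter, ← Fintype.sum_prod_type',
        ← (Fin.consEquiv fun _ => Finset V).sum_comp]
      refine sum_congr rfl fun ⟨D, g⟩ _ => ?_
      refine if_ctx_congr isRootedPartition_cons_iff (fun h => ?_) fun _ => rfl
      have tailUnion_zero : tailUnion (Fin.cons D g : Fin (i + 1) → Finset V) 0 = A := by
        rw [tailUnion_of_val_eq_zero _ rfl, (isRootedPartition_cons_iff.2 h).biUnion_eq]
      simp only [Fin.consEquiv, Equiv.coe_fn_mk, Fin.prod_univ_succ, tailUnion_zero,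
        tailUnion_cons_succ, Fin.cons_zero, Fin.cons_succ]
    _ = ∑ D with IsFirstPart D, alphaOn G D (root A) * rootedPartitionSum G root i (A \ D) := by
      simp only [ite_and, sum_filter, rootedPartitionSum, mul_sum, mul_ite, mul_zero, sum_ite_irrel,
        sum_const_zero]
    _ = _ := by
      refine sum_subset (fun D hD => mem_powerset.2 (mem_filter.1 hD).2.2.1) fun D hD hD' => ?_
      rw [mem_powerset] at hD
      refine mul_eq_zero_of_left (of_not_not fun h => hD' ?_) _
      obtain ⟨hroot, connected⟩ := mem_and_connected_of_alphaOn_ne_zero h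
      exact mem_filter.2 ⟨mem_univ D, connected, hD, hroot⟩

theorem coeff_chi_eq_rootedPartitionSum (G : SimpleGraph V) {root : Finset V → V}
    (hroot : ∀ A : Finset V, A.Nonempty → root A ∈ A) (i : ℕ) (A : Finset V) :
    (chi G A).coeff i = (-1) ^ (#A + i) * (rootedPartitionSum G root i A : ℤ) := by
  induction i generalizing A with
  | zero =>
    rw [coeff_zero_eq_eval_zero, chi_eval_zero, rootedPartitionSum_zero]
    split_ifs with hA <;> simp [hA]
  | succ i ih =>
    rcases A.eq_empty_or_nonempty with rfl | hA
    · simp [rootedPartitionSum_succ, alphaOn, chi_empty, coeff_one]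
    · rw [chi_eq_X_mul_sum G (hroot A hA), coeff_X_mul, finsetSum_coeff, rootedPartitionSum_succ,
        Nat.cast_sum, mul_sum]
      refine sum_congr rfl fun D hD => ?_
      rw [coeff_C_mul, ih, ← card_sdiff_add_card_eq_card (mem_powerset.1 hD)]
      push_cast
      ring

end RootedPartitions

section OrderedPartition

variable [LinearOrder V] {G : SimpleGraph V} {i : ℕ} {v : V}

/-- The selection rule of `OrderedPartition G i v`: the vertex `v` is selected from the sets that
contain it, and the least vertex from all the others. -/
def vertexOrLeast (v : V) (A : Finset V) : V :=
  if v ∈ A then v else A.min.untopD v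

theorem vertexOrLeast_of_mem {A : Finset V} (hv : v ∈ A) : vertexOrLeast v A = v :=
  if_pos hv

theorem vertexOrLeast_of_notMem {A : Finset V} (hv : v ∉ A) (hA : A.Nonempty) :
    vertexOrLeast v A = A.min' hA := by
  rw [vertexOrLeast, if_neg hv, ← coe_min' hA, WithTop.untopD_coe]

theorem vertexOrLeast_mem (v : V) (A : Finset V) (hA : A.Nonempty) : vertexOrLeast v A ∈ A := by
  by_cases hv : v ∈ A
  · rwa [vertexOrLeast_of_mem hv]
  · rw [vertexOrLeast_of_notMem hv hA]
    exact min'_mem A hA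

theorem isLeast_tailUnion_iff {f : Fin i → Finset V} {j : Fin i} {m : V} :
    IsLeast {u | ∃ s, j ≤ s ∧ u ∈ f s} m ↔ IsLeast (tailUnion f j : Set V) m := by
  simp only [← mem_tailUnion, setOfPred_mem]

theorem notMem_tailUnion {f : Fin i → Finset V} (disjoint : ∀ j k, j ≠ k → Disjoint (f j) (f k))
    {j k : Fin i} (hjk : j < k) {u : V} (hu : u ∈ f j) : u ∉ tailUnion f k := fun h => by
  obtain ⟨s, hks, hus⟩ := mem_tailUnion.1 h
  exact disjoint_left.1 (disjoint j s (hjk.trans_le hks).ne) hu hus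

namespace OrderedPartition

theorem vertexOrLeast_tailUnion_zero (P : OrderedPartition G i v) (hi : 0 < i) :
    vertexOrLeast v (tailUnion P.part ⟨0, hi⟩) = v :=
  vertexOrLeast_of_mem (subset_tailUnion _ _ (P.mem_first hi))

theorem vertexOrLeast_tailUnion_of_pos (P : OrderedPartition G i v) {j : Fin i}
    (hj : 0 < j.val) :
    vertexOrLeast v (tailUnion P.part j) = (P.part j).min' (P.nonempty j) := by
  obtain ⟨m, hm, least⟩ := P.least_mem j hj
  rw [isLeast_tailUnion_iff] at least
  have hv := notMem_tailUnion P.disjoint (j := ⟨0, hj.trans j.2⟩) hj (P.mem_first _)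
  have tail_nonempty := (P.nonempty j).mono (subset_tailUnion P.part j)
  rw [vertexOrLeast_of_notMem hv tail_nonempty, (isLeast_min' _ tail_nonempty).unique least]
  exact IsLeast.unique ⟨hm, fun u hu => least.2 (subset_tailUnion P.part j hu)⟩
    (isLeast_min' _ _)

theorem isRootedPartition [Fintype V] (P : OrderedPartition G i v) :
    IsRootedPartition G (vertexOrLeast v) univ P.part := by
  refine ⟨P.connected, P.disjoint, eq_univ_of_forall fun u => ?_, fun j => ?_⟩
  · obtain ⟨j, hj⟩ := P.cover u
    exact mem_biUnion.2 ⟨j, mem_univ j, hj⟩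
  · rcases j.val.eq_zero_or_pos with hj | hj
    · have hi : 0 < i := j.pos
      obtain rfl : j = ⟨0, hi⟩ := Fin.ext hj
      rw [P.vertexOrLeast_tailUnion_zero]
      exact P.mem_first _
    · rw [P.vertexOrLeast_tailUnion_of_pos hj]
      exact min'_mem _ _

end OrderedPartition

theorem IsRootedPartition.exists_orderedPartition [Fintype V] {f : Fin i → Finset V}
    (hf : IsRootedPartition G (vertexOrLeast v) univ f) :
    ∃ P : OrderedPartition G i v, P.part = f := by
  have nonempty (j : Fin i) : (f j).Nonempty := ⟨_, hf.root_mem j⟩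
  have mem_first (hi : 0 < i) : v ∈ f ⟨0, hi⟩ := by
    have root_mem := hf.root_mem ⟨0, hi⟩
    rwa [tailUnion_of_val_eq_zero f rfl, hf.biUnion_eq, vertexOrLeast_of_mem (mem_univ v)]
      at root_mem
  refine ⟨⟨f, nonempty, hf.disjoint, fun u => ?_, hf.connected, mem_first, fun j hj => ?_⟩, rfl⟩
  · simpa using hf.biUnion_eq.ge (mem_univ u)
  · have hv := notMem_tailUnion hf.disjoint (j := ⟨0, hj.trans j.2⟩) hj (mem_first _)
    have root_mem := hf.root_mem j
    rw [vertexOrLeast_of_notMem hv ((nonempty j).mono (subset_tailUnion f j))] at root_mem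
    exact ⟨_, root_mem, isLeast_tailUnion_iff.2 (isLeast_min' _ _)⟩

theorem prod_alphaOn_eq (P : OrderedPartition G i v) (hi : 0 < i) :
    ∏ j, alphaOn G (P.part j) (vertexOrLeast v (tailUnion P.part j)) =
      alpha (G.induce (P.part ⟨0, hi⟩ : Set V)) (P.root hi) *
        ∏ j : Fin i with 0 < j.val, alpha (G.induce (P.part j : Set V)) (P.least j) := by
  have filter_pos : univ.filter (fun j : Fin i => 0 < j.val) = univ.erase ⟨0, hi⟩ := by
    ext j
    simp [Fin.ext_iff, Nat.pos_iff_ne_zero]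
  rw [← mul_prod_erase univ _ (mem_univ ⟨0, hi⟩), ← filter_pos,
    P.vertexOrLeast_tailUnion_zero hi, alphaOn, dif_pos (P.mem_first hi)]
  refine congrArg _ (prod_congr rfl fun j hj => ?_)
  rw [P.vertexOrLeast_tailUnion_of_pos (mem_filter.1 hj).2, alphaOn, dif_pos (min'_mem _ _)]
  rfl

theorem rootedPartitionSum_vertexOrLeast [Fintype V] (G : SimpleGraph V) (v : V) (hi : 0 < i) :
    rootedPartitionSum G (vertexOrLeast v) i univ =
      ∑ P : OrderedPartition G i v,
        alpha (G.induce (P.part ⟨0, hi⟩ : Set V)) (P.root hi) *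
          ∏ j : Fin i with 0 < j.val, alpha (G.induce (P.part j : Set V)) (P.least j) := by
  classical
  rw [rootedPartitionSum]
  refine (sum_bij (fun P _ => P.part) (fun P _ => mem_filter.2 ⟨mem_univ _, P.isRootedPartition⟩)
    (fun _ _ _ _ => OrderedPartition.ext) (fun f hf => ?_)
    fun P _ => (prod_alphaOn_eq P hi).symm).symm
  obtain ⟨P, rfl⟩ := (mem_filter.1 hf).2.exists_orderedPartition
  exact ⟨P, mem_univ P, rfl⟩

end OrderedPartition

end ChromaticCoeff

theorem mainTheorem6_general {V : Type*} [Fintype V] [DecidableEq V] (G : SimpleGraph V)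
    {root : Finset V → V} (hroot : ∀ A : Finset V, A.Nonempty → root A ∈ A) {i : ℕ}
    (hin : i ≤ Fintype.card V) :
    ChromaticCoeff.chromaticCoeff G i =
      ChromaticCoeff.rootedPartitionSum G root i Finset.univ := by
  have sign_mul_sign : (-1 : ℤ) ^ (Fintype.card V - i) * (-1) ^ (Fintype.card V + i) = 1 := by
    rw [← pow_add, show Fintype.card V - i + (Fintype.card V + i) = 2 * Fintype.card V by omega,
      pow_mul, neg_one_sq, one_pow]
  rw [ChromaticCoeff.chromaticCoeff, ← ChromaticCoeff.chi_univ,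
    ChromaticCoeff.coeff_chi_eq_rootedPartitionSum G hroot, Finset.card_univ, ← mul_assoc,
    sign_mul_sign, one_mul]

theorem mainTheorem6 {V : Type*} [Fintype V] [LinearOrder V] (G : SimpleGraph V) (v : V)
    (i : ℕ) (hi : 1 ≤ i) (hin : i ≤ Fintype.card V) :
    ChromaticCoeff.chromaticCoeff G i =
      ((∑ P : ChromaticCoeff.OrderedPartition G i v,
          ChromaticCoeff.alpha (G.induce (P.part ⟨0, hi⟩ : Set V)) (P.root hi) *
            ∏ j : Fin i with 0 < j.val,
              ChromaticCoeff.alpha (G.induce (P.part j : Set V)) (P.least j) : ℕ) : ℤ) := by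
  rw [mainTheorem6_general G (ChromaticCoeff.vertexOrLeast_mem v) hin,
    ChromaticCoeff.rootedPartitionSum_vertexOrLeast G v hi]
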